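/- Let $n$ be a positive integer, $[n]=\{1,\dots,n\}$, and let $f:2^{[n]}\to\mathbb{Z}$ satisfy $f(\emptyset)=0$ and $f(I)+f(J)\ge f(I\cup J)+f(I\cap J)$ for all $I,J\subset[n]$. Let $$P=\Big\{a\in\mathbb{Z}^n \;\Big|\; \sum_{i\in I}a_i\le f(I)\text{ for all } I\subset[n],\ \sum_{i\in[n]}a_i=f([n])\Big\}$$ be the polymatroid over $[n]$ with rank function $f$. For a finite totally ordered set $E$ with canonical basis $(\mathbf e_i)_{i\in E}$ of $\mathbb{Z}^E$, a finite set $Q\subset\mathbb{Z}^E$ and $a\in Q$, call $i\in E$ internally active if $a-\mathbf e_i+\mathbf e_j\notin Q$ for every $j<i$, and externally active if $a+\mathbf e_i-\mathbf e_j\notin Q$ for every $j<i$. Let $\mathrm{Int}_Q(a)$ and $\mathrm{Ext}_Q(a)$ be the sets of internally and externally active elements, and define the interior and exterior polynomials $$I_Q(x)=\sum_{a\in Q}x^{|E|-|\mathrm{Int}_Q(a)|},\qquad X_Q(y)=\sum_{a\in Q}y^{|E|-|\mathrm{Ext}_Q(a)|}.$$ For $t\in[n]$ put $\alpha_t=f([n])-f([n]\setminus\{t\})$,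 $\beta_t=f(\{t\})$, $T_t=\{\alpha_t,\alpha_t+1,\dots,\beta_t\}$, and for $j\in T_t$ let $$\widehat P^t_j=\{(a_i)_{i\in[n]\setminus\{t\}} \mid a\in P,\ a_t=j\}\subset\mathbb{Z}^{[n]\setminus\{t\}},$$ where $[n]\setminus\{t\}$ carries the order inherited from $[n]$. Then, for every $t\in[n]$, $$I_P(x)=I_{\widehat P^t_{\alpha_t}}(x)+x\sum_{j\in T_t\setminus\{\alpha_t\}}I_{\widehat P^t_j}(x)$$ and $$X_P(y)=X_{\widehat P^t_{\beta_t}}(y)+y\sum_{j\in T_t\setminus\{\beta_t\}}X_{\widehat P^t_j}(y).$$ -/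

import Mathlib

open scoped Classical in
/-- The internally active indices of `a` with respect to `P`: the `i` such that
`a - e_i + e_j` is not in `P` for any `j < i`. -/
noncomputable def internallyActive {E : Type*} [Fintype E] [LinearOrder E]
    (P : Set (E → ℤ)) (a : E → ℤ) : Finset E :=
  Finset.univ.filter fun i => ∀ j, j < i → a - Pi.single i 1 + Pi.single j 1 ∉ P

open scoped Classical in
/-- The externally active indices of `a` with respect to `P`: the `i` such that
`a + e_i - e_j` is not in `P` for any `j < i`. -/
noncomputable def externallyActive {E : Type*} [Fintype E] [LinearOrder E]
    (P : Set (E → ℤ)) (a : E → ℤ) : Finset E :=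
  Finset.univ.filter fun i => ∀ j, j < i → a + Pi.single i 1 - Pi.single j 1 ∉ P

/-- The rank functions: integer-valued set functions that vanish at the empty set and are
submodular (neither monotonicity nor non-negativity is required). -/
structure IsRankFunction {E : Type*} [DecidableEq E] (f : Finset E → ℤ) : Prop where
  empty : f ∅ = 0
  submodular : ∀ I J : Finset E, f (I ∪ J) + f (I ∩ J) ≤ f I + f J

/-- The set `P_f` of (integer) bases determined by the set function `f`. -/
def basesOf {E : Type*} [Fintype E] (f : Finset E → ℤ) : Set (E → ℤ) :=
  {a | (∀ I : Finset E, ∑ i ∈ I, a i ≤ f I) ∧ ∑ i, a i = f Finset.univ}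

/-- `P` is a polymatroid over the ground set `E`, with rank function `f`. -/
def IsPolymatroid {E : Type*} [Fintype E] [DecidableEq E]
    (P : Set (E → ℤ)) (f : Finset E → ℤ) : Prop :=
  IsRankFunction f ∧ P = basesOf f

/-- The interior polynomial `∑_{a ∈ P} x ^ (|E| - |Int(a)|)`. The sum has its usual meaning for
every finite set `P`, in particular for polymatroids and their slices. -/
noncomputable def interiorPolynomial {E : Type*} [Fintype E] [LinearOrder E]
    (P : Set (E → ℤ)) : Polynomial ℤ :=
  ∑ᶠ a ∈ P, Polynomial.X ^ (Fintype.card E - (internallyActive P a).card)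

/-- The exterior polynomial `∑_{a ∈ P} y ^ (|E| - |Ext(a)|)`. -/
noncomputable def exteriorPolynomial {E : Type*} [Fintype E] [LinearOrder E]
    (P : Set (E → ℤ)) : Polynomial ℤ :=
  ∑ᶠ a ∈ P, Polynomial.X ^ (Fintype.card E - (externallyActive P a).card)

/-- The slice `P^t_j` of the points of `P` whose coordinate `t` is `j`. -/
def slice {E : Type*} (P : Set (E → ℤ)) (t : E) (j : ℤ) : Set (E → ℤ) :=
  {a | a ∈ P ∧ a t = j}

/-- The projected slice: delete the coordinate `t` from the points of `P^t_j`. It lives over the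
ground set `E ∖ {t}`, which is ordered as a subset of `E`. -/
def projSlice {E : Type*} (P : Set (E → ℤ)) (t : E) (j : ℤ) : Set ({i : E // i ≠ t} → ℤ) :=
  (fun (a : E → ℤ) (i : {i : E // i ≠ t}) => a i) '' slice P t j

/-- The number `α_t = f(E) - f(E ∖ {t})`. -/
def alphaOf {E : Type*} [Fintype E] [DecidableEq E] (f : Finset E → ℤ) (t : E) : ℤ :=
  f Finset.univ - f (Finset.univ \ {t})

/-- The number `β_t = f({t})`. -/
def betaOf {E : Type*} (f : Finset E → ℤ) (t : E) : ℤ := f {t}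

/-- The interval of integers `T_t = {α_t, α_t + 1, …, β_t}`. -/
noncomputable def rangeT {E : Type*} [Fintype E] [DecidableEq E] (f : Finset E → ℤ) (t : E) : Finset ℤ :=
  Finset.Icc (alphaOf f t) (betaOf f t)

/-- Polymatroids are finite, so the sums defining their polynomials are genuine. -/
theorem IsPolymatroid.finite {E : Type*} [Fintype E] [DecidableEq E]
    {P : Set (E → ℤ)} {f : Finset E → ℤ} (h : IsPolymatroid P f) : P.Finite := by
  refine (Set.finite_Icc (alphaOf f) (betaOf f)).subset ?_
  rw [h.2]
  rintro a ⟨ha, hs⟩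
  refine ⟨fun t => ?_, fun t => ?_⟩
  · have h1 := ha (Finset.univ \ {t})
    have h2 := Finset.sum_sdiff (f := a) (Finset.subset_univ {t})
    simp only [Finset.sum_singleton] at h2
    simp only [alphaOf]
    linarith
  · simpa [betaOf] using ha {t}

/-- Projected slices of polymatroids are finite as well. -/
theorem IsPolymatroid.finite_projSlice {E : Type*} [Fintype E] [DecidableEq E]
    {P : Set (E → ℤ)} {f : Finset E → ℤ} (h : IsPolymatroid P f) (t : E) (j : ℤ) :
    (projSlice P t j).Finite :=
  (h.finite.subset fun _ ha => ha.1).image _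

/-! ### Activity under negation. -/

section ActivityBasics

variable {E : Type*} [Fintype E]

/-! The exterior polynomial does not depend on the order of the ground set, so `t` may be taken
largest. Then the activity of `i ≠ t` is decided inside the slice through `a`, while `t` is active
exactly when `a t = β_t`; every other `a` contributes one extra factor `y`.

Order independence: each point of `P + ℕ^E` is uniquely `a + c` with `c` supported on `Ext(a)`.
Existence takes the lexicographically least `a`; uniqueness is the exchange property. Counting by
the degree `k` of `c`, `∑_a (1 - X)^(-|Ext(a)|)` is the generating function of the order-free
numbers `(upShift P k).ncard`; multiplied by `(1 - X)^|E|` it becomes `X_P(1 - X)`.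

Exchange and the criterion `a t = β_t` come from uniting tight sets. The interior case is the
exterior case for `-P`, again a polymatroid. -/

theorem mem_externallyActive_iff [DecidableEq E] [LinearOrder E] {P : Set (E → ℤ)} {a : E → ℤ}
    {i : E} : i ∈ externallyActive P a ↔
      ∀ j, j < i → a + Pi.single i 1 - Pi.single j 1 ∉ P := by
  simp only [externallyActive, Finset.mem_filter, Finset.mem_univ, true_and]
  convert Iff.rfl

/-- Negation exchanges internal and external activity. -/
theorem internallyActive_eq_externallyActive_neg [LinearOrder E] (P : Set (E → ℤ)) (a : E → ℤ) :
    internallyActive P a = externallyActive (-P) (-a) := by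
  ext i
  simp only [internallyActive, externallyActive, Finset.mem_filter, Finset.mem_univ, true_and,
    Set.mem_neg]
  refine forall₂_congr fun j _ => ?_
  rw [show -(-a + Pi.single i 1 - Pi.single j 1) = a - Pi.single i 1 + Pi.single j 1 by abel]

theorem interiorPolynomial_eq_exteriorPolynomial_neg [LinearOrder E] (P : Set (E → ℤ)) :
    interiorPolynomial P = exteriorPolynomial (-P) := by
  rw [interiorPolynomial, exteriorPolynomial, ← Set.image_neg_eq_neg,
    finsum_mem_image neg_injective.injOn, Set.image_neg_eq_neg]
  simp only [internallyActive_eq_externallyActive_neg]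

theorem exteriorPolynomial_eq_sum [LinearOrder E] {P : Set (E → ℤ)} (hP : P.Finite) :
    exteriorPolynomial P = ∑ a ∈ hP.toFinset,
      Polynomial.X ^ (Fintype.card E - (externallyActive P a).card) :=
  finsum_mem_eq_finite_toFinset_sum _ hP

end ActivityBasics

/-! ### Order independence of the exterior polynomial. -/

section Exchange

/-- The exchange property of M-convex sets. -/
def HasExchange {E : Type*} [DecidableEq E] (P : Set (E → ℤ)) : Prop :=
  ∀ a ∈ P, ∀ b ∈ P, ∀ i, b i < a i →
    ∃ j, a j < b j ∧ a - Pi.single i 1 + Pi.single j 1 ∈ P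

/-- The points obtained from those of `P` by `k` successive unit increments. -/
def upShift {E : Type*} [Fintype E] (P : Set (E → ℤ)) (k : ℕ) : Set (E → ℤ) :=
  {b | ∃ a ∈ P, ∃ c : E →₀ ℕ, ∑ i, c i = k ∧ b = fun i => a i + c i}

variable {E : Type*} [Fintype E]

/-- Every point of `upShift P k` lies above a point of `P` with the difference supported on the
externally active elements. -/
theorem exists_support_subset_externallyActive [DecidableEq E] [LinearOrder E]
    {P : Set (E → ℤ)} (hP : P.Finite) {k : ℕ} {b : E → ℤ} (hb : b ∈ upShift P k) :
    ∃ a ∈ P, ∃ c : E →₀ ℕ, ∑ i, c i = k ∧ (b = fun i => a i + c i) ∧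
      c.support ⊆ externallyActive P a := by
  classical
  let S : Set (Lex (E → ℤ)) :=
    toLex '' {a | a ∈ P ∧ ∃ c : E →₀ ℕ, ∑ i, c i = k ∧ b = fun i => a i + c i}
  have hS : S.Finite := (hP.subset fun _ h => h.1).image _
  obtain ⟨a₀, h₀, h₀'⟩ := hb
  obtain ⟨m, hm⟩ := hS.exists_minimal ⟨toLex a₀, a₀, ⟨h₀, h₀'⟩, rfl⟩
  obtain ⟨⟨a, ⟨ha, c, hc, hbc⟩, rfl⟩, hmin⟩ := hm
  refine ⟨a, ha, c, hc, hbc, fun i hi => ?_⟩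
  rw [mem_externallyActive_iff]
  intro j hj hmem
  have hci : 1 ≤ c i := Nat.one_le_iff_ne_zero.2 (Finsupp.mem_support_iff.1 hi)
  -- If `j < i` witnessed inactivity, moving a unit of `a` from `j` to `i`, and one of `c` from `i`
  -- to `j`, would give a smaller candidate.
  have hlt : toLex (a + Pi.single i 1 - Pi.single j 1) < toLex a := by
    refine ⟨j, fun l hl => ?_, ?_⟩
    · simp [hl.ne, (hl.trans hj).ne]
    · simp [hj.ne]
  have hle : Finsupp.single i 1 ≤ c := by
    simpa [Finsupp.single_le_iff] using hci
  obtain ⟨d, rfl⟩ := exists_add_of_le hle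
  refine absurd (hmin ⟨_, ⟨hmem, d + Finsupp.single j 1, ?_, ?_⟩, rfl⟩ hlt.le) (not_le_of_gt hlt)
  · rw [← hc]
    simp [Finset.sum_add_distrib, Finsupp.single_apply, add_comm]
  · rw [hbc]
    ext l
    simp only [Finsupp.add_apply, Finsupp.single_apply, Pi.add_apply, Pi.sub_apply,
      Pi.single_apply, eq_comm (a := l)]
    push_cast
    ring

/-- The point of `exists_support_subset_externallyActive` is unique. -/
theorem eq_of_support_subset_externallyActive [DecidableEq E] [LinearOrder E]
    {P : Set (E → ℤ)} (hex : HasExchange P) {a a' : E → ℤ} (ha : a ∈ P) (ha' : a' ∈ P)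
    {c c' : E →₀ ℕ} (hc : c.support ⊆ externallyActive P a)
    (hc' : c'.support ⊆ externallyActive P a') (h : ∀ i, a i + c i = a' i + c' i) : a = a' := by
  -- At the first disagreement `j`, exchange raises some `i > j` with `a i < a' i`. Then `c i > c' i
  -- ≥ 0`, so `i` is active, which forbids this very exchange.
  have key : ∀ {a a' : E → ℤ} {c c' : E →₀ ℕ}, a ∈ P → a' ∈ P →
      c.support ⊆ externallyActive P a → (∀ i, a i + c i = a' i + c' i) →
      ∀ j, (∀ l < j, a l = a' l) → ¬ a' j < a j := by
    intro a a' c c' ha ha' hc h j hj hlt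
    obtain ⟨i, hi, hmem⟩ := hex a ha a' ha' j hlt
    have hji : j < i := by
      rcases lt_trichotomy i j with h1 | rfl | h1
      · exact absurd (hj i h1) hi.ne
      · exact absurd hi hlt.asymm
      · exact h1
    have hci : i ∈ c.support := by
      rw [Finsupp.mem_support_iff]
      intro h0
      have := h i
      rw [h0] at this
      push_cast at this
      linarith [(c' i).cast_nonneg (α := ℤ)]
    refine mem_externallyActive_iff.1 (hc hci) j hji ?_
    rwa [show a + Pi.single i 1 - Pi.single j 1 = a - Pi.single j 1 + Pi.single i 1 by abel]
  by_contra hne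
  obtain ⟨j, hj, hmin⟩ := WellFounded.has_min (wellFounded_lt (α := E)) {j | a j ≠ a' j}
    (Function.ne_iff.1 hne)
  have hagree : ∀ l < j, a l = a' l := fun l hl => by
    by_contra hl'
    exact hmin l hl' hl
  rcases lt_or_gt_of_ne hj with h1 | h1
  · exact key ha' ha hc' (fun i => (h i).symm) j (fun l hl => (hagree l hl).symm) h1
  · exact key ha ha' hc h j hagree h1

theorem ncard_upShift [DecidableEq E] [LinearOrder E] {P : Set (E → ℤ)} (hP : P.Finite)
    (hex : HasExchange P) (k : ℕ) :
    (upShift P k).ncard =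
      ∑ a ∈ hP.toFinset, ((externallyActive P a).finsuppAntidiag k).card := by
  rw [← Finset.card_sigma, ← Set.ncard_coe_finset]
  symm
  refine Set.ncard_congr (fun p _ => fun i => p.1 i + p.2 i) ?_ ?_ ?_
  · rintro ⟨a, c⟩ h
    simp only [Finset.mem_coe, Finset.mem_sigma, Set.Finite.mem_toFinset,
      Finset.mem_finsuppAntidiag] at h
    refine ⟨a, h.1, c, ?_, rfl⟩
    rw [← h.2.1]
    exact (Finset.sum_subset (Finset.subset_univ _) fun i _ hi =>
      Finsupp.notMem_support_iff.1 fun hi' => hi (h.2.2 hi')).symm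
  · rintro ⟨a, c⟩ ⟨a', c'⟩ h h' heq
    simp only [Finset.mem_coe, Finset.mem_sigma, Set.Finite.mem_toFinset,
      Finset.mem_finsuppAntidiag] at h h'
    have heq' : ∀ i, a i + (c i : ℤ) = a' i + c' i := fun i => congrFun heq i
    obtain rfl := eq_of_support_subset_externallyActive hex h.1 h'.1 h.2.2 h'.2.2 heq'
    obtain rfl : c = c' := by
      ext i
      simpa using heq' i
    rfl
  · intro b hb
    obtain ⟨a, ha, c, hc, rfl, hsupp⟩ := exists_support_subset_externallyActive hP hb
    refine ⟨⟨a, c⟩, ?_, rfl⟩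
    simp only [Finset.mem_coe, Finset.mem_sigma, Set.Finite.mem_toFinset,
      Finset.mem_finsuppAntidiag]
    refine ⟨ha, ?_, hsupp⟩
    rw [← hc]
    exact Finset.sum_subset (Finset.subset_univ _) fun i _ hi =>
      Finsupp.notMem_support_iff.1 fun hi' => hi (hsupp hi')

theorem coeff_mk_one_pow_card {E : Type*} [DecidableEq E] (S : Finset E) (k : ℕ) :
    PowerSeries.coeff k ((PowerSeries.mk 1 : PowerSeries ℤ) ^ S.card) =
      (S.finsuppAntidiag k).card := by
  rw [← Finset.prod_const, PowerSeries.coeff_prod]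
  simp

theorem mk_ncard_upShift [DecidableEq E] [LinearOrder E] {P : Set (E → ℤ)} (hP : P.Finite)
    (hex : HasExchange P) :
    (PowerSeries.mk fun k => ((upShift P k).ncard : ℤ)) =
      ∑ a ∈ hP.toFinset, (PowerSeries.mk 1 : PowerSeries ℤ) ^ (externallyActive P a).card := by
  ext k
  simp [ncard_upShift hP hex, coeff_mk_one_pow_card]

/-- The exterior polynomial in `1 - X`, in terms of an order-free generating function. -/
theorem exteriorPolynomial_comp_one_sub_X [DecidableEq E] [LinearOrder E] {P : Set (E → ℤ)}
    (hP : P.Finite) (hex : HasExchange P) :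
    (((exteriorPolynomial P).comp (1 - Polynomial.X) : Polynomial ℤ) : PowerSeries ℤ) =
      (1 - PowerSeries.X) ^ Fintype.card E *
        PowerSeries.mk fun k => ((upShift P k).ncard : ℤ) := by
  rw [mk_ncard_upShift hP hex, exteriorPolynomial_eq_sum hP, Finset.mul_sum,
    Polynomial.sum_comp, ← Polynomial.coeToPowerSeries.ringHom_apply, map_sum]
  refine Finset.sum_congr rfl fun a _ => ?_
  have hcard := Finset.card_le_univ (externallyActive P a)
  conv_rhs => rw [← Nat.sub_add_cancel hcard]
  rw [pow_add, mul_assoc, ← mul_pow, mul_comm (1 - PowerSeries.X) (PowerSeries.mk 1),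
    PowerSeries.mk_one_mul_one_sub_eq_one, one_pow, mul_one]
  simp

/-- The exterior polynomial does not depend on the order of the ground set. -/
theorem exteriorPolynomial_order_independent [DecidableEq E] (L₁ L₂ : LinearOrder E)
    {P : Set (E → ℤ)} (hP : P.Finite) (hex : HasExchange P) :
    @exteriorPolynomial E _ L₁ P = @exteriorPolynomial E _ L₂ P := by
  have h : (@exteriorPolynomial E _ L₁ P).comp (1 - Polynomial.X) =
      (@exteriorPolynomial E _ L₂ P).comp (1 - Polynomial.X) := by
    rw [← Polynomial.coe_inj, @exteriorPolynomial_comp_one_sub_X E _ _ L₁ P hP hex,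
      @exteriorPolynomial_comp_one_sub_X E _ _ L₂ P hP hex]
  -- Substituting `1 - X` is an involution.
  have h' := congrArg (fun p => Polynomial.comp p (1 - Polynomial.X)) h
  simpa [Polynomial.comp_assoc] using h'

end Exchange

/-! ### Deleting the largest element. -/

section Slices

variable {E : Type*}

theorem hasExchange_projSlice [DecidableEq E] {P : Set (E → ℤ)} (hex : HasExchange P) (t : E)
    (j : ℤ) : HasExchange (projSlice P t j) := by
  rintro _ ⟨a, ⟨ha, hat⟩, rfl⟩ _ ⟨b, ⟨hb, hbt⟩, rfl⟩ i hi
  obtain ⟨l, hl, hmem⟩ := hex a ha b hb i hi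
  have hlt : l ≠ t := by
    rintro rfl
    omega
  refine ⟨⟨l, hlt⟩, hl, _, ⟨hmem, ?_⟩, ?_⟩
  · simp [hat, hlt.symm, i.2.symm]
  · ext m
    simp [Pi.single_apply, Subtype.ext_iff]

theorem injOn_restrict_slice (P : Set (E → ℤ)) (t : E) (j : ℤ) :
    Set.InjOn (fun (a : E → ℤ) (i : {i : E // i ≠ t}) => a i) (slice P t j) := by
  rintro a ⟨_, ha⟩ b ⟨_, hb⟩ h
  ext i
  by_cases hi : i = t
  · rw [hi, ha, hb]
  · exact congrFun h ⟨i, hi⟩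

theorem neg_projSlice (P : Set (E → ℤ)) (t : E) (j : ℤ) :
    -projSlice P t j = projSlice (-P) t (-j) := by
  ext b
  simp only [Set.mem_neg, projSlice, slice, Set.mem_image, Set.mem_ofPred_eq]
  constructor
  · rintro ⟨a, ⟨ha, hat⟩, h⟩
    refine ⟨-a, ⟨by simpa using ha, by simp [hat]⟩, ?_⟩
    ext i
    have := congrFun h i
    simp only [Pi.neg_apply] at this ⊢
    omega
  · rintro ⟨a, ⟨ha, hat⟩, rfl⟩
    exact ⟨-a, ⟨ha, by simp [hat]⟩, rfl⟩

variable [Fintype E] [DecidableEq E]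

/-- As `j < i ≤ t`, no exchange tested at `i` touches `t`, so all of them stay in the slice. -/
theorem mem_externallyActive_projSlice [LinearOrder E] {P : Set (E → ℤ)} {t : E} {a : E → ℤ}
    (ht : ∀ i, i ≤ t) (i : {i : E // i ≠ t}) :
    i ∈ externallyActive (projSlice P t (a t)) (fun i => a i) ↔
      (i : E) ∈ externallyActive P a := by
  simp only [mem_externallyActive_iff]
  have hlift : ∀ j : {i : E // i ≠ t}, ((fun i : {i : E // i ≠ t} => a i) + Pi.single i 1 -
      Pi.single j 1 ∈ projSlice P t (a t)) ↔
      a + Pi.single (i : E) 1 - Pi.single (j : E) 1 ∈ P := by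
    intro j
    constructor
    · rintro ⟨b, ⟨hb, hbt⟩, h⟩
      convert hb using 1
      ext m
      by_cases hm : m = t
      · subst hm
        simp [hbt, i.2.symm, j.2.symm]
      · have := congrFun h ⟨m, hm⟩
        simp only [Pi.add_apply, Pi.sub_apply, Pi.single_apply, Subtype.ext_iff] at this ⊢
        exact this.symm
    · intro h
      refine ⟨_, ⟨h, by simp [i.2.symm, j.2.symm]⟩, ?_⟩
      ext m
      simp [Pi.single_apply, Subtype.ext_iff]
  constructor
  · intro h j hj hmem
    have hjt : j ≠ t := (hj.trans_le (ht i)).ne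
    exact h ⟨j, hjt⟩ hj ((hlift ⟨j, hjt⟩).2 hmem)
  · intro h j hj hmem
    exact h j hj ((hlift j).1 hmem)

theorem card_externallyActive_eq_projSlice [LinearOrder E] {P : Set (E → ℤ)} {t : E}
    {a : E → ℤ} (ht : ∀ i, i ≤ t) :
    (externallyActive P a).card =
      (externallyActive (projSlice P t (a t)) fun i => a i).card +
        if t ∈ externallyActive P a then 1 else 0 := by
  have h : (externallyActive P a).erase t =
      (externallyActive (projSlice P t (a t)) fun i => a i).map (Function.Embedding.subtype _) := by
    ext i
    simp only [Finset.mem_erase, Finset.mem_map, Function.Embedding.coe_subtype]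
    constructor
    · rintro ⟨hi, h⟩
      exact ⟨⟨i, hi⟩, (mem_externallyActive_projSlice ht _).2 h, rfl⟩
    · rintro ⟨i, h, rfl⟩
      exact ⟨i.2, (mem_externallyActive_projSlice ht _).1 h⟩
  have h' := congrArg Finset.card h
  rw [Finset.card_map] at h'
  split_ifs with hmem
  · rw [← h', Finset.card_erase_add_one hmem]
  · rw [← h', Finset.erase_eq_of_notMem hmem, add_zero]

theorem exteriorPolynomial_projSlice [LinearOrder E] {P : Set (E → ℤ)} (hP : P.Finite) (t : E)
    (j : ℤ) :
    exteriorPolynomial (projSlice P t j) = ∑ a ∈ hP.toFinset with a t = j,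
      Polynomial.X ^ (Fintype.card {i : E // i ≠ t} -
        (externallyActive (projSlice P t (a t)) fun i => a i).card) := by
  have hfin : (slice P t j).Finite := hP.subset fun _ h => h.1
  have hset : hfin.toFinset = {a ∈ hP.toFinset | a t = j} := by
    ext a
    simp [slice]
  rw [exteriorPolynomial]
  conv_lhs => rw [projSlice.eq_def P t j]
  rw [finsum_mem_image (injOn_restrict_slice P t j), finsum_mem_eq_finite_toFinset_sum _ hfin, hset]
  refine Finset.sum_congr rfl fun a ha => ?_
  rw [← (Finset.mem_filter.1 ha).2]
  rfl

/-- The recursion for the exterior polynomial when the deleted element is the largest one. -/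
theorem exteriorPolynomial_recursion_of_max [LinearOrder E] {P : Set (E → ℤ)} (hP : P.Finite)
    {t : E} (ht : ∀ i, i ≤ t) {β : ℤ} {T : Finset ℤ} (hT : ∀ a ∈ P, a t ∈ T)
    (hβ : ∀ a ∈ P, (∀ i, i ≠ t → a + Pi.single t 1 - Pi.single i 1 ∉ P) ↔ a t = β) :
    exteriorPolynomial P = exteriorPolynomial (projSlice P t β) +
      Polynomial.X * ∑ j ∈ T \ {β}, exteriorPolynomial (projSlice P t j) := by
  simp only [exteriorPolynomial_projSlice hP]
  rw [Finset.sum_congr rfl fun j hj => show _ = ∑ a ∈ {a ∈ hP.toFinset | ¬ a t = β} with a t = j,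
      Polynomial.X ^ (Fintype.card {i : E // i ≠ t} -
        (externallyActive (projSlice P t (a t)) fun i => a i).card) by
    congr 1
    ext a
    have : j ≠ β := by simpa using (Finset.mem_sdiff.1 hj).2
    simp only [Finset.mem_filter]
    constructor
    · rintro ⟨h1, rfl⟩
      exact ⟨⟨h1, this⟩, rfl⟩
    · rintro ⟨⟨h1, -⟩, h2⟩
      exact ⟨h1, h2⟩]
  rw [Finset.sum_fiberwise_of_maps_to (fun a ha => by
      simp only [Finset.mem_filter, Set.Finite.mem_toFinset] at ha
      simpa using ⟨hT a ha.1, ha.2⟩), exteriorPolynomial_eq_sum hP, Finset.mul_sum,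
    ← Finset.sum_filter_add_sum_filter_not hP.toFinset (fun a => a t = β)]
  have hact : ∀ a ∈ P, (t ∈ externallyActive P a ↔ a t = β) := by
    intro a ha
    rw [mem_externallyActive_iff, ← hβ a ha]
    exact forall_congr' fun i => by rw [lt_iff_le_and_ne, and_iff_right (ht i)]
  have hE : Fintype.card E = Fintype.card {i : E // i ≠ t} + 1 := by
    have : 0 < Fintype.card E := Fintype.card_pos_iff.2 ⟨t⟩
    rw [Fintype.card_subtype_compl, Fintype.card_subtype_eq]
    omega
  congr 1
  · refine Finset.sum_congr rfl fun a ha => ?_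
    simp only [Finset.mem_filter, Set.Finite.mem_toFinset] at ha
    rw [card_externallyActive_eq_projSlice ht, if_pos ((hact a ha.1).2 ha.2), hE,
      Nat.add_sub_add_right]
  · refine Finset.sum_congr rfl fun a ha => ?_
    simp only [Finset.mem_filter, Set.Finite.mem_toFinset] at ha
    rw [card_externallyActive_eq_projSlice ht, if_neg (mt (hact a ha.1).1 ha.2), hE, ← pow_succ',
      add_zero, Nat.sub_add_comm (Finset.card_le_univ _)]

theorem exists_linearOrder_max {E : Type*} [LinearOrder E] (t : E) :
    ∃ L : LinearOrder E, ∀ i, L.le i t := by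
  let g : E → WithTop E := fun i => if i = t then ⊤ else i
  have hg : Function.Injective g := by
    intro i j h
    by_cases hi : i = t <;> by_cases hj : j = t <;> simp_all [g]
  refine ⟨LinearOrder.lift' g hg, fun i => ?_⟩
  change g i ≤ g t
  simp [g]

/-- The recursion for the exterior polynomial of a set with the exchange property. -/
theorem exteriorPolynomial_recursion_of_hasExchange [L₀ : LinearOrder E] {P : Set (E → ℤ)}
    (hex : HasExchange P) (hP : P.Finite) {t : E} {β : ℤ} {T : Finset ℤ} (hT : ∀ a ∈ P, a t ∈ T)
    (hβ : ∀ a ∈ P, (∀ i, i ≠ t → a + Pi.single t 1 - Pi.single i 1 ∉ P) ↔ a t = β) :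
    exteriorPolynomial P = exteriorPolynomial (projSlice P t β) +
      Polynomial.X * ∑ j ∈ T \ {β}, exteriorPolynomial (projSlice P t j) := by
  -- The slices must change order along with `P`; they inherit exchange, so order independence
  -- applies to them too.
  have hslice : ∀ (L' : LinearOrder {i : E // i ≠ t}) (j : ℤ),
      @exteriorPolynomial _ _ (@Subtype.instLinearOrder E L₀ _) (projSlice P t j) =
        @exteriorPolynomial _ _ L' (projSlice P t j) := fun L' j =>
    exteriorPolynomial_order_independent _ _ ((hP.subset fun _ h => h.1).image _)
      (hasExchange_projSlice hex t j)
  obtain ⟨L, hL⟩ := exists_linearOrder_max t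
  rw [exteriorPolynomial_order_independent L₀ L hP hex, hslice (@Subtype.instLinearOrder E L _) β,
    Finset.sum_congr rfl fun j _ => hslice (@Subtype.instLinearOrder E L _) j]
  exact @exteriorPolynomial_recursion_of_max E _ _ L P hP t hL β T hT hβ

end Slices

/-! ### Tight sets, exchange and duality for polymatroids. -/

section Polymatroids

variable {E : Type*} [Fintype E] [DecidableEq E]

/-- If `a - e_i + e_j` is not a basis for any `j ∈ J`, then some tight set contains `J` but
not `i`. -/
theorem exists_tight_superset {f : Finset E → ℤ} (hf : IsRankFunction f) {a : E → ℤ}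
    (ha : a ∈ basesOf f) {i : E} (J : Finset E)
    (hJ : ∀ j ∈ J, j ≠ i ∧ a - Pi.single i 1 + Pi.single j 1 ∉ basesOf f) :
    ∃ U, J ⊆ U ∧ i ∉ U ∧ ∑ l ∈ U, a l = f U := by
  induction J using Finset.induction_on with
  | empty => exact ⟨∅, by simp, by simp, by simp [hf.empty]⟩
  | insert j J _ ih =>
    obtain ⟨U, hU, hiU, hUt⟩ := ih fun l hl => hJ l (Finset.mem_insert_of_mem hl)
    obtain ⟨hji, hj⟩ := hJ j (Finset.mem_insert_self _ _)
    -- Only sets containing `j` but not `i` gain from the move, by one; by integrality one of them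
    -- must have no slack.
    obtain ⟨V, hjV, hiV, hVt⟩ : ∃ V, j ∈ V ∧ i ∉ V ∧ ∑ l ∈ V, a l = f V := by
      by_contra! hno
      refine hj ⟨fun V => ?_, ?_⟩
      · have h1 := ha.1 V
        simp only [Pi.add_apply, Pi.sub_apply, Finset.sum_add_distrib, Finset.sum_sub_distrib,
          Finset.sum_pi_single']
        by_cases hjV : j ∈ V <;> by_cases hiV : i ∈ V <;> simp only [hjV, hiV, if_true, if_false]
        · omega
        · have := hno V hjV hiV
          omega
        · omega
        · omega
      · simp [Finset.sum_add_distrib, Finset.sum_sub_distrib, ha.2]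
    -- Submodularity makes the union of two tight sets tight.
    refine ⟨U ∪ V, ?_, by simp [hiU, hiV], ?_⟩
    · exact Finset.insert_subset (Finset.mem_union_right _ hjV)
        (hU.trans Finset.subset_union_left)
    · have h1 := hf.submodular U V
      have h2 := Finset.sum_union_inter (s₁ := U) (s₂ := V) (f := a)
      have h3 := ha.1 (U ∪ V)
      have h4 := ha.1 (U ∩ V)
      omega

theorem IsPolymatroid.hasExchange {P : Set (E → ℤ)} {f : Finset E → ℤ}
    (h : IsPolymatroid P f) : HasExchange P := by
  obtain ⟨hf, rfl⟩ := h
  intro a ha b hb i hi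
  by_contra! hno
  obtain ⟨U, hU, hiU, hUt⟩ := exists_tight_superset hf ha {j | a j < b j} fun j hj => by
    have hj' : a j < b j := by simpa using hj
    refine ⟨?_, hno j hj'⟩
    rintro rfl
    omega
  -- Outside `U` no coordinate of `b` exceeds that of `a`, and `i` is strict; on the tight set `U`,
  -- `b` has sum at most that of `a`. The totals then cannot agree.
  have h1 : ∑ l ∈ Uᶜ, b l < ∑ l ∈ Uᶜ, a l := by
    refine Finset.sum_lt_sum (fun l hl => ?_) ⟨i, by simpa using hiU, hi⟩
    by_contra! hl'
    exact Finset.mem_compl.1 hl (hU (by simpa using hl'))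
  have h2 := Finset.sum_add_sum_compl U a
  have h3 := Finset.sum_add_sum_compl U b
  have h4 := hb.1 U
  have h5 := ha.2
  have h6 := hb.2
  omega

/-- The rank function of the negative of a polymatroid. -/
def dualRank (f : Finset E → ℤ) (I : Finset E) : ℤ := f Iᶜ - f Finset.univ

theorem IsPolymatroid.neg {P : Set (E → ℤ)} {f : Finset E → ℤ} (h : IsPolymatroid P f) :
    IsPolymatroid (-P) (dualRank f) := by
  obtain ⟨hf, rfl⟩ := h
  refine ⟨⟨by simp [dualRank], fun I J => ?_⟩, ?_⟩
  · have := hf.submodular Iᶜ Jᶜ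
    simp only [dualRank, Finset.compl_union, Finset.compl_inter]
    omega
  · ext a
    simp only [Set.mem_neg, basesOf, Set.mem_ofPred_eq, dualRank, Pi.neg_apply,
      Finset.sum_neg_distrib, Finset.compl_univ, hf.empty]
    constructor
    · rintro ⟨h1, h2⟩
      refine ⟨fun I => ?_, by omega⟩
      have h3 := h1 Iᶜ
      have h4 := Finset.sum_add_sum_compl I a
      omega
    · rintro ⟨h1, h2⟩
      refine ⟨fun I => ?_, by omega⟩
      have h3 := h1 Iᶜ
      have h4 := Finset.sum_add_sum_compl I a
      rw [compl_compl] at h3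
      omega

theorem alphaOf_dualRank (f : Finset E → ℤ) (hf : f ∅ = 0) (t : E) :
    alphaOf (dualRank f) t = -betaOf f t := by
  simp [alphaOf, betaOf, dualRank, hf, ← Finset.compl_eq_univ_sdiff, sub_eq_add_neg]

theorem betaOf_dualRank (f : Finset E → ℤ) (t : E) :
    betaOf (dualRank f) t = -alphaOf f t := by
  simp [alphaOf, betaOf, dualRank, Finset.compl_eq_univ_sdiff]

theorem IsPolymatroid.apply_mem_rangeT {P : Set (E → ℤ)} {f : Finset E → ℤ}
    (h : IsPolymatroid P f) {a : E → ℤ} (ha : a ∈ P) (t : E) : a t ∈ rangeT f t := by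
  rw [h.2] at ha
  have h1 := ha.1 (Finset.univ \ {t})
  have h2 := Finset.sum_sdiff (f := a) (Finset.subset_univ {t})
  have h3 := ha.2
  have h4 : a t ≤ f {t} := by simpa using ha.1 {t}
  rw [Finset.sum_singleton] at h2
  rw [rangeT, Finset.mem_Icc, alphaOf, betaOf]
  omega

/-- No unit of the coordinate `t` can be moved elsewhere exactly when it has its least value. -/
theorem IsPolymatroid.forall_sub_add_notMem_iff {P : Set (E → ℤ)} {f : Finset E → ℤ}
    (h : IsPolymatroid P f) {a : E → ℤ} (ha : a ∈ P) (t : E) :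
    (∀ i, i ≠ t → a - Pi.single t 1 + Pi.single i 1 ∉ P) ↔ a t = alphaOf f t := by
  constructor
  · intro hno
    rw [h.2] at ha hno
    obtain ⟨U, hU, htU, hUt⟩ := exists_tight_superset h.1 ha (Finset.univ \ {t}) fun i hi => by
      have : i ≠ t := by simpa using hi
      exact ⟨this, hno i this⟩
    obtain rfl : U = Finset.univ \ {t} := by
      refine Finset.Subset.antisymm (fun i hi => ?_) hU
      simp only [Finset.mem_sdiff, Finset.mem_univ, Finset.mem_singleton, true_and]
      rintro rfl
      exact htU hi
    have h2 := Finset.sum_sdiff (f := a) (Finset.subset_univ {t})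
    have h3 := ha.2
    rw [Finset.sum_singleton] at h2
    rw [alphaOf]
    omega
  · intro hat i hi hmem
    have h1 := h.apply_mem_rangeT hmem t
    simp only [rangeT, Finset.mem_Icc, Pi.add_apply, Pi.sub_apply, Pi.single_eq_same,
      Pi.single_eq_of_ne hi.symm] at h1
    omega

/-- No unit can be moved to the coordinate `t` exactly when it has its greatest value. -/
theorem IsPolymatroid.forall_add_sub_notMem_iff {P : Set (E → ℤ)} {f : Finset E → ℤ}
    (h : IsPolymatroid P f) {a : E → ℤ} (ha : a ∈ P) (t : E) :
    (∀ i, i ≠ t → a + Pi.single t 1 - Pi.single i 1 ∉ P) ↔ a t = betaOf f t := by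
  have key := h.neg.forall_sub_add_notMem_iff (a := -a) (by simpa using ha) t
  rw [alphaOf_dualRank f h.1.empty, Pi.neg_apply, neg_inj] at key
  rw [← key]
  refine forall₂_congr fun i _ => ?_
  rw [Set.mem_neg, show -(-a - Pi.single t 1 + Pi.single i 1) =
    a + Pi.single t 1 - Pi.single i 1 by abel]

theorem IsPolymatroid.exteriorPolynomial_recursion [LinearOrder E] {P : Set (E → ℤ)}
    {f : Finset E → ℤ} (h : IsPolymatroid P f) (t : E) :
    exteriorPolynomial P = exteriorPolynomial (projSlice P t (betaOf f t)) +
      Polynomial.X *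
        ∑ j ∈ rangeT f t \ {betaOf f t}, exteriorPolynomial (projSlice P t j) :=
  exteriorPolynomial_recursion_of_hasExchange h.hasExchange h.finite (fun _ ha => h.apply_mem_rangeT ha t)
    fun _ ha => h.forall_add_sub_notMem_iff ha t

theorem IsPolymatroid.interiorPolynomial_recursion [LinearOrder E] {P : Set (E → ℤ)}
    {f : Finset E → ℤ} (h : IsPolymatroid P f) (t : E) :
    interiorPolynomial P = interiorPolynomial (projSlice P t (alphaOf f t)) +
      Polynomial.X *
        ∑ j ∈ rangeT f t \ {alphaOf f t}, interiorPolynomial (projSlice P t j) := by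
  simp only [interiorPolynomial_eq_exteriorPolynomial_neg, neg_projSlice]
  rw [h.neg.exteriorPolynomial_recursion t, betaOf_dualRank]
  congr 2
  -- The range of `-P` at `t` is the reflected range of `P`.
  refine Finset.sum_nbij' (fun j => -j) (fun j => -j) ?_ ?_ ?_ ?_ ?_
  · intro j hj
    simp only [rangeT, Finset.mem_sdiff, Finset.mem_Icc, Finset.mem_singleton,
      alphaOf_dualRank f h.1.empty, betaOf_dualRank] at hj ⊢
    omega
  · intro j hj
    simp only [rangeT, Finset.mem_sdiff, Finset.mem_Icc, Finset.mem_singleton,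
      alphaOf_dualRank f h.1.empty, betaOf_dualRank] at hj ⊢
    omega
  · simp
  · simp
  · simp

end Polymatroids

theorem corollary3p6 (n : ℕ) (P : Set (Fin n → ℤ)) (f : Finset (Fin n) → ℤ)
    (hP : IsPolymatroid P f) (t : Fin n) :
    (interiorPolynomial P = interiorPolynomial (projSlice P t (alphaOf f t)) +
        Polynomial.X *
          ∑ j ∈ rangeT f t \ {alphaOf f t}, interiorPolynomial (projSlice P t j)) ∧
    (exteriorPolynomial P = exteriorPolynomial (projSlice P t (betaOf f t)) +
        Polynomial.X *
          ∑ j ∈ rangeT f t \ {betaOf f t}, exteriorPolynomial (projSlice P t j)) :=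
  ⟨hP.interiorPolynomial_recursion t, hP.exteriorPolynomial_recursion t⟩
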